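/- Let $X$ be a real Banach space with continuous dual $X^*$, and let $F:X\times X\to\mathbb{R}$ satisfy $F(x,x)=0$ for all $x\in X$ and be monotone, that is, $F(x,y)+F(y,x)\le 0$ for all $x,y\in X$. Define the set-valued operator $A^F:X\rightrightarrows X^*$ by $$A^F(x)=\{x^*\in X^*: F(x,y)-F(x,x)\ge \langle x^*,y-x\rangle\ \text{ for all } y\in X\}.$$ Assume that $A^F(x)\neq\emptyset$ for every $x\in X$ (i.e. $D(A^F)=X$), and that for every $y\in X$ the function $F(\cdot,y)$ is upper hemicontinuous, i.e. its restriction to every line segment $[a,b]\subseteq X$ is upper semicontinuous. Then $F$ is maximal monotone, that is, $A^F$ is a maximal monotone operator: $\langle y^*-x^*,y-x\rangle\ge 0$ whenever $x^*\in A^F(x)$ and $y^*\in A^F(y)$, and the graph $\{(x,x^*)\in X\times X^*: x^*\in A^F(x)\}$ is not properly included in the graph of any other monotone operator $S:X\rightrightarrows X^*$. -/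

import Mathlib

namespace MonotoneBifunctions

section Operators

variable {X : Type*} [NormedAddCommGroup X] [NormedSpace ℝ X]

/-- The graph of a multifunction from `X` to its continuous dual. -/
def graph (T : X → Set (StrongDual ℝ X)) : Set (X × StrongDual ℝ X) :=
  {p | p.2 ∈ T p.1}

/-- The domain of a multifunction: the points with a nonempty value. -/
def domain (T : X → Set (StrongDual ℝ X)) : Set X :=
  {x | (T x).Nonempty}

/-- Monotonicity of a multifunction from `X` to its continuous dual. -/
def IsMonotoneOperator (T : X → Set (StrongDual ℝ X)) : Prop :=
  ∀ x y : X, ∀ xs ∈ T x, ∀ ys ∈ T y, 0 ≤ (ys - xs) (y - x)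

/-- A monotone operator is maximal when its graph is not properly included in the graph of any
monotone operator. -/
def IsMaximalMonotoneOperator (T : X → Set (StrongDual ℝ X)) : Prop :=
  IsMonotoneOperator T ∧
    ∀ S : X → Set (StrongDual ℝ X), IsMonotoneOperator S → ¬ graph T ⊂ graph S

/-- Upper hemicontinuity of a real function: upper semicontinuity on line segments. -/
def IsUpperHemicontinuous (f : X → ℝ) : Prop :=
  ∀ a b : X, UpperSemicontinuousOn f (segment ℝ a b)

/-- The operator `A^F` attached to a bifunction `F : X × X → ℝ`. -/
def bifunctionOperator (F : X → X → ℝ) (x : X) : Set (StrongDual ℝ X) :=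
  {xs | ∀ y : X, xs (y - x) ≤ F x y - F x x}

/-- Monotonicity of a bifunction. -/
def IsMonotoneBifunction (F : X → X → ℝ) : Prop :=
  ∀ x y : X, F x y + F y x ≤ 0

/-- A monotone bifunction is maximal monotone when the operator `A^F` is maximal monotone. -/
def IsMaximalMonotoneBifunction (F : X → X → ℝ) : Prop :=
  IsMonotoneBifunction F ∧ IsMaximalMonotoneOperator (bifunctionOperator F)

end Operators

end MonotoneBifunctions

/-!
Let `(x, xs)` be monotonically related to the graph of `A^F`. Given `y`, pick a point
`z = x + t (y - x)` with `0 < t < 1` and some `zs ∈ A^F z`. Relatedness gives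
`xs (y - x) ≤ zs (y - x)`, and the defining inequality of `A^F z`, tested at `y`, gives
`(1 - t) zs (y - x) ≤ F z y`. Hence `(1 - t) xs (y - x) ≤ F z y`, and letting `t → 0⁺`, upper
semicontinuity along the segment yields `xs (y - x) ≤ F x y`, that is, `xs ∈ A^F x`. This is
Minty's argument for bifunctions.
-/

open AffineMap Filter Set Topology

namespace MonotoneBifunctions

section Semicontinuity

theorem le_of_tendsto_of_upperSemicontinuousWithinAt {ι α β : Type*} [TopologicalSpace α]
    [LinearOrder β] [DenselyOrdered β] [TopologicalSpace β] [OrderTopology β] {l : Filter ι}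
    [l.NeBot] {f : α → β} {s : Set α} {a : α} {c : β} {u : ι → α} {v : ι → β}
    (hf : UpperSemicontinuousWithinAt f s a) (hu : Tendsto u l (𝓝[s] a))
    (hv : Tendsto v l (𝓝 c)) (hvf : ∀ᶠ i in l, v i ≤ f (u i)) : c ≤ f a := by
  by_contra! hlt
  obtain ⟨m, hfm, hmc⟩ := exists_between hlt
  have hfu : ∀ᶠ i in l, f (u i) < m := hu.eventually (hf m hfm)
  obtain ⟨i, hi, hmi, him⟩ := (hvf.and ((hv.eventually_const_lt hmc).and hfu)).exists
  exact (hmi.trans_le hi).not_gt him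

theorem tendsto_lineMap_nhdsWithin_segment {E : Type*} [AddCommGroup E] [Module ℝ E]
    [TopologicalSpace E] [IsTopologicalAddGroup E] [ContinuousSMul ℝ E] (x y : E) :
    Tendsto (lineMap x y : ℝ → E) (𝓝[>] 0) (𝓝[segment ℝ x y] x) := by
  refine tendsto_nhdsWithin_iff.2 ⟨?_, ?_⟩
  · exact (lineMap_continuous.tendsto' 0 x (lineMap_apply_zero x y)).mono_left nhdsWithin_le_nhds
  · filter_upwards [Ioo_mem_nhdsGT one_pos] with t ht
    exact lineMap_mem_segment ℝ x y (Ioo_subset_Icc_self ht)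

end Semicontinuity

section Operators

variable {X : Type*} [NormedAddCommGroup X] [NormedSpace ℝ X]

/-- The pair `(x, xs)` is monotonically related to the graph of `T`: it satisfies the monotonicity
inequality against every point of the graph, so adding it to the graph of a monotone `T` keeps `T`
monotone. A monotone operator is maximal when its graph contains all such pairs. -/
def IsMonotonicallyRelated (T : X → Set (StrongDual ℝ X)) (x : X) (xs : StrongDual ℝ X) : Prop :=
  ∀ z : X, ∀ zs ∈ T z, 0 ≤ (zs - xs) (z - x)

variable {T : X → Set (StrongDual ℝ X)} {F : X → X → ℝ} {x y : X} {xs zs : StrongDual ℝ X} {t : ℝ}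

theorem IsMonotoneOperator.isMaximalMonotoneOperator (hT : IsMonotoneOperator T)
    (hmem : ∀ x xs, IsMonotonicallyRelated T x xs → xs ∈ T x) : IsMaximalMonotoneOperator T := by
  refine ⟨hT, fun S hS hTS => hTS.2 ?_⟩
  rintro ⟨x, xs⟩ hxs
  exact hmem x xs fun z zs hzs => hS x z xs hxs zs (hTS.subset (show (z, zs) ∈ graph T from hzs))

theorem IsMonotonicallyRelated.apply_sub_le_of_mem_lineMap (h : IsMonotonicallyRelated T x xs)
    (ht : 0 < t) (hzs : zs ∈ T (lineMap x y t)) : xs (y - x) ≤ zs (y - x) := by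
  have hrel : 0 ≤ t * (zs - xs) (y - x) := by
    simpa only [← vsub_eq_sub, lineMap_vsub_left, map_smul, smul_eq_mul] using h _ zs hzs
  exact sub_nonneg.1 (nonneg_of_mul_nonneg_right hrel ht)

theorem one_sub_mul_apply_sub_le_of_mem_bifunctionOperator
    (hzs : zs ∈ bifunctionOperator F (lineMap x y t)) :
    (1 - t) * zs (y - x) ≤ F (lineMap x y t) y - F (lineMap x y t) (lineMap x y t) := by
  simpa only [← vsub_eq_sub, right_vsub_lineMap, map_smul, smul_eq_mul] using hzs y

theorem IsMonotoneBifunction.isMonotoneOperator (hF : IsMonotoneBifunction F)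
    (hdiag : ∀ x, F x x = 0) : IsMonotoneOperator (bifunctionOperator F) := by
  intro x y xs hxs ys hys
  have hx : xs (y - x) ≤ F x y := by simpa only [hdiag, sub_zero] using hxs y
  have hy : -ys (y - x) ≤ F y x := by
    simpa only [hdiag, sub_zero, ← map_neg, neg_sub] using hys x
  rw [sub_apply]
  linarith [hF x y]

theorem IsMonotonicallyRelated.apply_sub_le
    (h : IsMonotonicallyRelated (bifunctionOperator F) x xs) (hdiag : ∀ z, F z z = 0)
    (hdom : openSegment ℝ x y ⊆ domain (bifunctionOperator F))
    (husc : UpperSemicontinuousWithinAt (fun z => F z y) (segment ℝ x y) x) :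
    xs (y - x) ≤ F x y := by
  have hbound : ∀ t ∈ Ioo (0 : ℝ) 1, (1 - t) * xs (y - x) ≤ F (lineMap x y t) y := by
    intro t ht
    obtain ⟨zs, hzs⟩ := hdom (lineMap_mem_openSegment ℝ x y ht)
    calc (1 - t) * xs (y - x)
        ≤ (1 - t) * zs (y - x) := mul_le_mul_of_nonneg_left
          (h.apply_sub_le_of_mem_lineMap ht.1 hzs) (sub_nonneg.2 ht.2.le)
      _ ≤ F (lineMap x y t) y - F (lineMap x y t) (lineMap x y t) :=
          one_sub_mul_apply_sub_le_of_mem_bifunctionOperator hzs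
      _ = F (lineMap x y t) y := by rw [hdiag, sub_zero]
  have hlim : Tendsto (fun t : ℝ => (1 - t) * xs (y - x)) (𝓝[>] 0) (𝓝 (xs (y - x))) :=
    ((by fun_prop : Continuous fun t : ℝ => (1 - t) * xs (y - x)).tendsto' 0 _
      (by rw [sub_zero, one_mul])).mono_left nhdsWithin_le_nhds
  exact le_of_tendsto_of_upperSemicontinuousWithinAt (f := fun z => F z y) husc
    (tendsto_lineMap_nhdsWithin_segment x y) hlim
    (eventually_of_mem (Ioo_mem_nhdsGT one_pos) hbound)

end Operators

end MonotoneBifunctions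

theorem mainTheorem3_general {X : Type*} [NormedAddCommGroup X] [NormedSpace ℝ X]
    (F : X → X → ℝ)
    (hmono : MonotoneBifunctions.IsMonotoneBifunction F)
    (hdiag : ∀ x : X, F x x = 0)
    (hdom : MonotoneBifunctions.domain (MonotoneBifunctions.bifunctionOperator F) = Set.univ)
    (husc : ∀ x y : X, UpperSemicontinuousWithinAt (fun z => F z y) (segment ℝ x y) x) :
    MonotoneBifunctions.IsMaximalMonotoneBifunction F := by
  refine ⟨hmono, (hmono.isMonotoneOperator hdiag).isMaximalMonotoneOperator ?_⟩
  intro x xs hxs y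
  rw [hdiag, sub_zero]
  exact hxs.apply_sub_le hdiag (hdom ▸ subset_univ _) (husc x y)

theorem mainTheorem3 {X : Type*} [NormedAddCommGroup X] [NormedSpace ℝ X] [CompleteSpace X]
    (F : X → X → ℝ)
    (hmono : MonotoneBifunctions.IsMonotoneBifunction F)
    (hdiag : ∀ x : X, F x x = 0)
    (hdom : MonotoneBifunctions.domain (MonotoneBifunctions.bifunctionOperator F) = Set.univ)
    (husc : ∀ y : X, MonotoneBifunctions.IsUpperHemicontinuous (fun x => F x y)) :
    MonotoneBifunctions.IsMaximalMonotoneBifunction F :=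
  mainTheorem3_general F hmono hdiag hdom fun x y => husc y x y x (left_mem_segment ℝ x y)
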